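/- Let $G$ be a finite group, $G'$ its commutator subgroup, $\hat G=\mathrm{Hom}(G,\mathbb C^*)$, and let $f\in Z^2(G,\mathbb C^*)$ be a 2-cocycle for the trivial action. The twisted group algebra $\mathbb C^fG$ is the associative $\mathbb C$-algebra with basis $\{u_g\}_{g\in G}$ and multiplication $u_xu_y=f(x,y)u_{xy}$; the group $G$ acts on it by $g(a)=u_g\,a\,u_g^{-1}$. For $\lambda\in\hat G$ let $(\mathbb C^fG)_\lambda=\{a : g(a)=\lambda(g)a \text{ for all } g\in G\}$; the nonzero elements of these spaces are called semi-invariant, and the semi-center $\mathrm{Sz}(\mathbb C^fG)$ is the subalgebra spanned by them. For commuting $g,h$ put $\alpha_f(g,h)=f(g,h)f(h,g)^{-1}$. An element $x\in G$ is $f$-regular if $\alpha_f(x,h)=1$ for all $h\in C_G(x)$, and $(\lambda,f)$-regular if $\lambda(g)=\alpha_f(g,x)$ for all $g\in C_G(x)$. Let $\Gamma(f)$ be a set of representatives of the conjugacy classes of $G$ that are $(\lambda,f)$-regular for some $\lambda\in\hat G$, each such class being represented once. Assume that $f$ is nondegenerate, that is, $1$ is the only $f$-regular element of $G$. Then the following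 objects exist. (a) There is a unique group homomorphism $\varphi:\hat G\to G/G'$ such that for every $\lambda\in\hat G$ there is an $x\in G$ with $\varphi(\lambda)=xG'$ for which $(\mathbb C^fG)_\lambda\neq 0$ and every nonzero element of $(\mathbb C^fG)_\lambda$ has the conjugacy class $[x]$ as its support. (b) There is a cocycle $\hat f\in Z^2(\hat G,\mathbb C^*)$ with $\mathrm{Sz}(\mathbb C^fG)=\mathbb C^{\hat f}\hat G$ as $\hat G$-graded algebras, that is, such that there is an algebra isomorphism $\mathbb C^{\hat f}\hat G\to\mathrm{Sz}(\mathbb C^fG)$ that maps $u_\lambda$ into $(\mathbb C^fG)_\lambda$ for every $\lambda\in\hat G$. Moreover, for every such $\hat f$ and every such $\Gamma(f)$ the following are equivalent: 1. $\ker\varphi=\hat G$; in other words, for every $\lambda\in\hat G$ all $(\lambda,f)$-regular conjugacy classes are contained in $G'$. 2. $\hat f$ is cohomologically trivial. 3. $\mathrm{Sz}(\mathbb C^fG)$ is commutative. 4. $\displaystyle\sum_{x\in\Gamma(f)\cap G'}[G:G'C_G(x)]=|\hat G|$. If these conditions hold, then $Z(G)\le G'$. -/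

import Mathlib

noncomputable section

/-- The group `Z²(G, ℂˣ)` of (not necessarily normalized) `2`-cocycles of `G`
with values in `ℂˣ`, on which `G` acts trivially. -/
@[ext]
structure TwoCocycle (G : Type*) [Group G] where
  /-- the underlying function of two variables -/
  toFun : G → G → ℂˣ
  cocycle : ∀ x y z : G, toFun x y * toFun (x * y) z = toFun y z * toFun x (y * z)

namespace TwoCocycle

variable {G : Type*} [Group G]

instance : CoeFun (TwoCocycle G) (fun _ => G → G → ℂˣ) := ⟨TwoCocycle.toFun⟩

/-- The cocycle condition is the one of Mathlib for the trivial action on `ℂˣ`. -/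
theorem isMulCocycle₂ (f : TwoCocycle G) :
    @groupCohomology.IsMulCocycle₂ G ℂˣ _ _ ⟨fun _ z => z⟩ (fun p => f p.1 p.2) := by
  intro x y z
  show f (x * y) z * f x y = f y z * f x (y * z)
  rw [mul_comm]
  exact f.cocycle x y z

/-- `f` is cohomologically trivial: it is the coboundary of a function `t : G → ℂˣ`. -/
def IsCohomologicallyTrivial (f : TwoCocycle G) : Prop :=
  ∃ t : G → ℂˣ, ∀ x y : G, f x y = t x * t y * (t (x * y))⁻¹

theorem map_one_left (f : TwoCocycle G) (x : G) : f 1 x = f 1 1 := by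
  have h := f.cocycle 1 1 x
  simp only [one_mul] at h
  exact (mul_right_cancel (h.trans (mul_comm _ _))).symm

theorem map_one_right (f : TwoCocycle G) (x : G) : f x 1 = f 1 1 := by
  have h := f.cocycle x 1 1
  simp only [mul_one] at h
  exact mul_right_cancel h

/-- `α_f(g₁, g₂) = f(g₁, g₂) f(g₂, g₁)⁻¹`; used on commuting pairs only. -/
def alpha (f : TwoCocycle G) (g₁ g₂ : G) : ℂˣ := f g₁ g₂ * (f g₂ g₁)⁻¹

/-- `g` is `f`-regular: `α_f(g, h) = 1` for every `h` in the centralizer of `g`. -/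
def IsRegular (f : TwoCocycle G) (g : G) : Prop :=
  ∀ h ∈ Subgroup.centralizer {g}, f.alpha g h = 1

/-- `f` is nondegenerate: `1` is the only `f`-regular element. -/
def IsNondegenerate (f : TwoCocycle G) : Prop :=
  ∀ g : G, f.IsRegular g ↔ g = 1

/-- `x` is `(chi, f)`-regular: `chi(g) = α_f(g, x)` for every `g` in the centralizer of `x`. -/
def IsCharRegular (f : TwoCocycle G) (chi : G →* ℂˣ) (x : G) : Prop :=
  ∀ g ∈ Subgroup.centralizer {x}, chi g = f.alpha g x

/-- `Γ` is a set of representatives of the conjugacy classes of `G` that are `(chi, f)`-regular for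
some one-dimensional character `chi` (each such class is represented exactly once). -/
def IsRegularTransversal (f : TwoCocycle G) (Γ : Set G) : Prop :=
  (∀ x ∈ Γ, ∃ chi : G →* ℂˣ, f.IsCharRegular chi x) ∧
    ∀ x : G, (∃ chi : G →* ℂˣ, f.IsCharRegular chi x) → ∃! y : G, y ∈ Γ ∧ IsConj x y

end TwoCocycle

/-- The underlying vector space of the twisted group algebra `ℂ^f G`, with basis indexed by `G`. -/
def TwistedGroupAlgebra {G : Type*} [Group G] (_f : TwoCocycle G) : Type _ := G →₀ ℂ

namespace TwistedGroupAlgebra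

variable {G : Type*} [Group G]

variable {f : TwoCocycle G}

instance : AddCommGroup (TwistedGroupAlgebra f) := inferInstanceAs (AddCommGroup (G →₀ ℂ))

instance : Module ℂ (TwistedGroupAlgebra f) := inferInstanceAs (Module ℂ (G →₀ ℂ))

/-- The element `r • u_x`. -/
def single (f : TwoCocycle G) (x : G) (r : ℂ) : TwistedGroupAlgebra f := Finsupp.single x r

/-- The support of an element of `ℂ^f G`: the set of `x` at which its coefficient is nonzero. -/
def support (a : TwistedGroupAlgebra f) : Set G := {x | (show G →₀ ℂ from a) x ≠ 0}

theorem induction {p : TwistedGroupAlgebra f → Prop} (a : TwistedGroupAlgebra f) (h0 : p 0)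
    (hadd : ∀ a b, p a → p b → p (a + b)) (hs : ∀ x r, p (single f x r)) : p a :=
  Finsupp.induction_linear (motive := p) a h0 hadd hs

/-- The linear map on `ℂ^f G` with prescribed values on the basis elements. -/
def lift (f : TwoCocycle G) {M : Type*} [AddCommGroup M] [Module ℂ M] (v : G → M) :
    TwistedGroupAlgebra f →ₗ[ℂ] M :=
  show (G →₀ ℂ) →ₗ[ℂ] M from Finsupp.lift M ℂ G v

theorem lift_single {M : Type*} [AddCommGroup M] [Module ℂ M] (v : G → M) (x : G) (r : ℂ) :
    lift f v (single f x r) = r • v x :=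
  Finsupp.sum_single_index (zero_smul _ _)

/-- Multiplication as a bilinear map: `u_x u_y = f(x, y) u_{xy}`. -/
def mulLin (f : TwoCocycle G) :
    TwistedGroupAlgebra f →ₗ[ℂ] TwistedGroupAlgebra f →ₗ[ℂ] TwistedGroupAlgebra f :=
  lift f fun x => lift f fun y => single f (x * y) (f x y)

instance : Mul (TwistedGroupAlgebra f) := ⟨fun a b => mulLin f a b⟩

instance : One (TwistedGroupAlgebra f) := ⟨single f 1 ((f 1 1)⁻¹ : ℂˣ)⟩

theorem smul_single (c : ℂ) (x : G) (r : ℂ) : c • single f x r = single f x (c * r) :=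
  Finsupp.smul_single' c x r

theorem single_mul_single (x y : G) (r s : ℂ) :
    single f x r * single f y s = single f (x * y) (r * s * f x y) := by
  show mulLin f (single f x r) (single f y s) = _
  rw [mulLin, lift_single, LinearMap.smul_apply, lift_single, smul_single, smul_single, mul_assoc]

theorem one_def : (1 : TwistedGroupAlgebra f) = single f 1 ((f 1 1)⁻¹ : ℂˣ) := rfl

instance : NonUnitalNonAssocRing (TwistedGroupAlgebra f) where
  left_distrib a b c := map_add (mulLin f a) b c
  right_distrib a b c := by
    show mulLin f (a + b) c = mulLin f a c + mulLin f b c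
    rw [map_add, LinearMap.add_apply]
  zero_mul a := by
    show mulLin f 0 a = 0
    rw [map_zero, LinearMap.zero_apply]
  mul_zero a := map_zero (mulLin f a)

protected theorem mul_assoc (a b c : TwistedGroupAlgebra f) : a * b * c = a * (b * c) := by
  induction a using TwistedGroupAlgebra.induction with
  | h0 => simp
  | hadd a a' h h' => simp only [add_mul, h, h']
  | hs x r =>
    induction b using TwistedGroupAlgebra.induction with
    | h0 => simp
    | hadd b b' h h' => simp only [add_mul, mul_add, h, h']
    | hs y s =>
      induction c using TwistedGroupAlgebra.induction with
      | h0 => simp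
      | hadd c c' h h' => simp only [mul_add, h, h']
      | hs z t =>
        simp only [single_mul_single, mul_assoc x y z]
        congr 1
        have h := congrArg (fun v : ℂˣ => (v : ℂ)) (f.cocycle x y z)
        simp only [Units.val_mul] at h
        linear_combination (r * s * t) * h

protected theorem one_mul (a : TwistedGroupAlgebra f) : 1 * a = a := by
  induction a using TwistedGroupAlgebra.induction with
  | h0 => simp
  | hadd a b h h' => rw [mul_add, h, h']
  | hs x r =>
    rw [one_def, single_mul_single, one_mul, f.map_one_left x, mul_right_comm, Units.inv_mul,
      one_mul]

protected theorem mul_one (a : TwistedGroupAlgebra f) : a * 1 = a := by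
  induction a using TwistedGroupAlgebra.induction with
  | h0 => simp
  | hadd a b h h' => rw [add_mul, h, h']
  | hs x r =>
    rw [one_def, single_mul_single, mul_one, f.map_one_right x, mul_assoc, Units.inv_mul, mul_one]

/-- The ring structure of the twisted group algebra. -/
instance : Ring (TwistedGroupAlgebra f) where
  mul_assoc := TwistedGroupAlgebra.mul_assoc
  one_mul := TwistedGroupAlgebra.one_mul
  mul_one := TwistedGroupAlgebra.mul_one

/-- The twisted group algebra `ℂ^f G` is an associative `ℂ`-algebra. -/
instance : Algebra ℂ (TwistedGroupAlgebra f) :=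
  Algebra.ofModule
    (fun c a b => by
      show mulLin f (c • a) b = c • mulLin f a b
      rw [map_smul, LinearMap.smul_apply])
    (fun c a b => map_smul (mulLin f a) c b)

end TwistedGroupAlgebra

namespace TwoCocycle

variable {G : Type*} [Group G]

/-- The basis element `u_x` of `ℂ^f G`, as a unit. -/
def u (f : TwoCocycle G) (x : G) : (TwistedGroupAlgebra f)ˣ where
  val := TwistedGroupAlgebra.single f x 1
  inv := TwistedGroupAlgebra.single f x⁻¹ ((f 1 1)⁻¹ * (f x⁻¹ x)⁻¹ : ℂˣ)
  val_inv := by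
    have h : f x x⁻¹ = f x⁻¹ x := by
      have h := f.cocycle x x⁻¹ x
      rw [mul_inv_cancel, inv_mul_cancel, f.map_one_left x, f.map_one_right x] at h
      exact mul_right_cancel h
    rw [TwistedGroupAlgebra.single_mul_single, TwistedGroupAlgebra.one_def, mul_inv_cancel, h,
      one_mul, ← Units.val_mul,
      inv_mul_cancel_right]
  inv_val := by
    rw [TwistedGroupAlgebra.single_mul_single, TwistedGroupAlgebra.one_def, inv_mul_cancel, mul_one, ← Units.val_mul,
      inv_mul_cancel_right]

/-- The conjugation action of `g` on `ℂ^f G`: `g(a) = u_g a u_g⁻¹`. -/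
def act (f : TwoCocycle G) (g : G) (a : TwistedGroupAlgebra f) : TwistedGroupAlgebra f :=
  (f.u g : TwistedGroupAlgebra f) * a * ((f.u g)⁻¹ : (TwistedGroupAlgebra f)ˣ)

/-- The weight space `(ℂ^f G)_chi`: the semi-invariants of weight `chi`, and zero. -/
def weightSpace (f : TwoCocycle G) (chi : G →* ℂˣ) : Submodule ℂ (TwistedGroupAlgebra f) where
  carrier := {a | ∀ g : G, f.act g a = (chi g : ℂ) • a}
  zero_mem' g := by simp [act]
  add_mem' {a b} ha hb g := by
    have h : f.act g (a + b) = f.act g a + f.act g b := by simp [act, mul_add, add_mul]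
    rw [h, ha g, hb g, smul_add]
  smul_mem' c a ha g := by
    have h : f.act g (c • a) = c • f.act g a := by simp [act]
    rw [h, ha g, smul_comm]

/-- A nonzero element is semi-invariant if it lies in a weight space. -/
def IsSemiInvariant (f : TwoCocycle G) (a : TwistedGroupAlgebra f) : Prop :=
  a ≠ 0 ∧ ∃ chi : G →* ℂˣ, ∀ g : G, f.act g a = (chi g : ℂ) • a

theorem act_mul (f : TwoCocycle G) (g : G) (a b : TwistedGroupAlgebra f) :
    f.act g (a * b) = f.act g a * f.act g b := by
  simp [act, mul_assoc]

/-- The semi-center `Sz(ℂ^f G)`: the subalgebra spanned by the semi-invariant elements. -/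
def semicenter (f : TwoCocycle G) : Subalgebra ℂ (TwistedGroupAlgebra f) :=
  (Submodule.span ℂ {a | f.IsSemiInvariant a}).toSubalgebra
    (by
      by_cases h : (1 : TwistedGroupAlgebra f) = 0
      · rw [h]
        exact Submodule.zero_mem _
      · exact Submodule.subset_span ⟨h, 1, fun g => by simp [act]⟩)
    (by
      intro a b ha hb
      induction ha using Submodule.span_induction with
      | zero => simp
      | add a a' _ _ h h' =>
        rw [add_mul]
        exact Submodule.add_mem _ h h'
      | smul c a _ h =>
        rw [smul_mul_assoc]
        exact Submodule.smul_mem _ c h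
      | mem a ha =>
        induction hb using Submodule.span_induction with
        | zero => simp
        | add b b' _ _ h h' =>
          rw [mul_add]
          exact Submodule.add_mem _ h h'
        | smul c b _ h =>
          rw [mul_smul_comm]
          exact Submodule.smul_mem _ c h
        | mem b hb =>
          obtain ⟨-, chi, hchi⟩ := ha
          obtain ⟨-, psi, hpsi⟩ := hb
          by_cases h : a * b = 0
          · rw [h]
            exact Submodule.zero_mem _
          · refine Submodule.subset_span ⟨h, chi * psi, fun g => ?_⟩
            rw [act_mul, hchi, hpsi, smul_mul_smul_comm, MonoidHom.mul_apply, Units.val_mul])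

/-- `phi : Ĝ → G/G'` is the homomorphism attached to `f`: for every `chi`, the weight space
`(ℂ^f G)_chi` is nonzero, all its nonzero elements have one and the same conjugacy class `[x]` as
their support, and `phi(chi) = xG'`. -/
def IsSupportHom (f : TwoCocycle G) (phi : (G →* ℂˣ) →* Abelianization G) : Prop :=
  ∀ chi : G →* ℂˣ, ∃ x : G, f.weightSpace chi ≠ ⊥ ∧
    (∀ a ∈ f.weightSpace chi, a ≠ 0 → a.support = conjugatesOf x) ∧
    phi chi = Abelianization.of x

/-- `fhat ∈ Z²(Ĝ, ℂˣ)` is a cocycle with `Sz(ℂ^f G) = ℂ^fhat Ĝ` as `Ĝ`-graded algebras: there is an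
algebra isomorphism that sends each basis element `u_chi` into the weight space of `chi`. -/
def IsSemicenterCocycle (f : TwoCocycle G) (fhat : TwoCocycle (G →* ℂˣ)) : Prop :=
  ∃ e : TwistedGroupAlgebra fhat ≃ₐ[ℂ] f.semicenter,
    ∀ chi : G →* ℂˣ,
      (e (fhat.u chi : TwistedGroupAlgebra fhat) : TwistedGroupAlgebra f) ∈ f.weightSpace chi

end TwoCocycle

end

/-! Averaging over `G` with weight `chi⁻¹` projects, up to the factor `|G|`, onto the weight space
of `chi`. Nondegeneracy says that invariants are scalars. Hence a nonzero semi-invariant has a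
semi-invariant left inverse (`exists_mul_eq_one`), each weight space is at most a line
(`exists_eq_smul`), and a double-sum identity shows that it is nonzero
(`exists_weightProj_ne_zero`). A generator `v chi` is supported on a single conjugacy class, that of
the `(chi, f)`-regular elements. Multiplying generators makes `chi ↦ xG'` a homomorphism and gives
the structure constants `fhat`.

The equivalences rest on `v psi * v chi = chi(x) • (v chi * v psi)`, with `x` in the support of `v
psi` (`mul_eq_smul_mul`): since characters separate the points of `G/G'`, the semi-center is
commutative iff every such `x` lies in `G'`. A commutative semi-center has a complex point, whose
values on the basis trivialize `fhat`. The sum in the last condition is always `|ker phi|`, because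
the characters for which a given `x` is regular form a coset of the characters trivial on `G'
C_G(x)`. -/

/-- The number of one-dimensional characters that are trivial on a subgroup containing `G'`. -/
theorem card_monoidHom_le_ker {G : Type*} [Group G] [Finite G] {H : Subgroup G}
    (hH : commutator G ≤ H) : Nat.card {chi : G →* ℂˣ // H ≤ chi.ker} = H.index := by
  have : H.Normal := by
    refine ⟨fun n hn g => ?_⟩
    have h := H.mul_mem (hH (Subgroup.commutator_mem_commutator (Subgroup.mem_top g)
      (Subgroup.mem_top n))) hn
    rwa [commutatorElement_def, inv_mul_cancel_right] at h
  have hc := Subgroup.Normal.quotient_commutative_iff_commutator_le.2 hH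
  let : CommGroup (G ⧸ H) :=
    { (inferInstance : Group (G ⧸ H)) with mul_comm := fun a b => hc.is_comm.comm a b }
  -- A finite abelian group has as many complex characters as elements; characters trivial on `H`
  -- are those of `G ⧸ H`.
  rw [Subgroup.index, ← CommGroup.card_monoidHom_of_hasEnoughRootsOfUnity (G ⧸ H) ℂ]
  refine Nat.card_congr
    { toFun := fun chi => QuotientGroup.lift H chi.1 chi.2
      invFun := fun psi => ⟨psi.comp (QuotientGroup.mk' H), fun h hh => ?_⟩
      left_inv := fun chi => Subtype.ext (MonoidHom.ext fun g => rfl)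
      right_inv := fun psi => ?_ }
  · rw [MonoidHom.mem_ker, MonoidHom.comp_apply, QuotientGroup.mk'_apply,
      (QuotientGroup.eq_one_iff h).2 hh, map_one]
  · ext g
    rfl

/-- A nonzero finite-dimensional commutative `ℂ`-algebra has a complex point. -/
theorem exists_algHom_complex (A : Type*) [CommRing A] [Algebra ℂ A] [Module.Finite ℂ A]
    [Nontrivial A] : Nonempty (A →ₐ[ℂ] ℂ) := by
  obtain ⟨m, hm⟩ := Ideal.exists_maximal A
  let := Ideal.Quotient.field m
  have : Module.Finite ℂ (A ⧸ m) := Module.Finite.of_surjective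
    (Ideal.Quotient.mkₐ ℂ m).toLinearMap (Ideal.Quotient.mkₐ_surjective ℂ m)
  have hbij : Function.Bijective (algebraMap ℂ (A ⧸ m)) :=
    IsAlgClosed.algebraMap_bijective_of_isIntegral
  exact ⟨((AlgEquiv.ofBijective (Algebra.ofId ℂ (A ⧸ m)) hbij).symm : (A ⧸ m) →ₐ[ℂ] ℂ).comp
    (Ideal.Quotient.mkₐ ℂ m)⟩

/-! ### Coordinates in the twisted group algebra. -/

namespace TwistedGroupAlgebra

variable {G : Type*} [Group G] {f : TwoCocycle G}

/-- The coefficient of `u_x`, as a linear functional. -/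
noncomputable def coeff (f : TwoCocycle G) (x : G) : TwistedGroupAlgebra f →ₗ[ℂ] ℂ :=
  show (G →₀ ℂ) →ₗ[ℂ] ℂ from Finsupp.lapply x

theorem coeff_single_self (x : G) (r : ℂ) : coeff f x (single f x r) = r :=
  Finsupp.single_eq_same

theorem coeff_single_of_ne {x y : G} (h : x ≠ y) (r : ℂ) : coeff f y (single f x r) = 0 :=
  Finsupp.single_eq_of_ne h.symm

theorem ext_coeff {a b : TwistedGroupAlgebra f} (h : ∀ x, coeff f x a = coeff f x b) : a = b :=
  Finsupp.ext (f := (a : G →₀ ℂ)) (g := (b : G →₀ ℂ)) h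

theorem mem_support {a : TwistedGroupAlgebra f} {x : G} : x ∈ a.support ↔ coeff f x a ≠ 0 :=
  Iff.rfl

theorem exists_mem_support {a : TwistedGroupAlgebra f} (ha : a ≠ 0) : ∃ x, x ∈ a.support := by
  by_contra! h
  refine ha (ext_coeff fun x => ?_)
  rw [map_zero]
  exact not_not.1 (h x)

/-- The basis `u_x` of the twisted group algebra. -/
noncomputable def basis (f : TwoCocycle G) : Module.Basis G ℂ (TwistedGroupAlgebra f) :=
  ⟨show (G →₀ ℂ) ≃ₗ[ℂ] (G →₀ ℂ) from LinearEquiv.refl ℂ _⟩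

instance [Finite G] : Module.Finite ℂ (TwistedGroupAlgebra f) := .of_basis (basis f)

theorem sum_coeff_smul_u [Fintype G] (a : TwistedGroupAlgebra f) :
    ∑ x, coeff f x a • (f.u x : TwistedGroupAlgebra f) = a :=
  (basis f).sum_repr a

instance : Nontrivial (TwistedGroupAlgebra f) := by
  refine ⟨single f 1 1, 0, fun h => ?_⟩
  have := congrArg (coeff f 1) h
  rw [coeff_single_self, map_zero] at this
  exact one_ne_zero this

theorem u_eq_single (x : G) : (f.u x : TwistedGroupAlgebra f) = single f x 1 := rfl

theorem single_eq_smul_u (x : G) (r : ℂ) : single f x r = r • (f.u x : TwistedGroupAlgebra f) := by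
  rw [u_eq_single, smul_single, mul_one]

theorem u_mul_u (x y : G) :
    (f.u x : TwistedGroupAlgebra f) * f.u y =
      (f x y : ℂ) • (f.u (x * y) : TwistedGroupAlgebra f) := by
  rw [u_eq_single, u_eq_single, single_mul_single, single_eq_smul_u, one_mul, one_mul]

theorem u_one : (f.u 1 : TwistedGroupAlgebra f) = (f 1 1 : ℂ) • 1 := by
  rw [u_eq_single, one_def, smul_single, Units.mul_inv]

theorem coeff_mul_u_mul (x y : G) (a : TwistedGroupAlgebra f) :
    coeff f (x * y) (f.u x * a) = f x y * coeff f y a := by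
  induction a using TwistedGroupAlgebra.induction with
  | h0 => simp
  | hadd a b h h' => rw [mul_add, map_add, h, h', map_add, mul_add]
  | hs z r =>
    rw [u_eq_single, single_mul_single]
    by_cases h : z = y
    · subst h
      rw [coeff_single_self, coeff_single_self, one_mul, mul_comm]
    · rw [coeff_single_of_ne h, coeff_single_of_ne (by simpa using h), mul_zero]

end TwistedGroupAlgebra

/-! ### The conjugation action, weights and supports. -/

namespace TwoCocycle

open TwistedGroupAlgebra

variable {G : Type*} [Group G] {f : TwoCocycle G}

theorem act_eq_iff {g : G} {a b : TwistedGroupAlgebra f} :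
    f.act g a = b ↔ (f.u g : TwistedGroupAlgebra f) * a = b * f.u g :=
  Units.mul_inv_eq_iff_eq_mul _

theorem u_mul (g : G) (a : TwistedGroupAlgebra f) :
    (f.u g : TwistedGroupAlgebra f) * a = f.act g a * f.u g :=
  act_eq_iff.1 rfl

/-- The conjugation action of `g` as a linear map. -/
noncomputable def actLin (f : TwoCocycle G) (g : G) :
    TwistedGroupAlgebra f →ₗ[ℂ] TwistedGroupAlgebra f :=
  LinearMap.mulRight ℂ ((f.u g)⁻¹ : (TwistedGroupAlgebra f)ˣ) ∘ₗ LinearMap.mulLeft ℂ (f.u g)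

theorem actLin_apply (g : G) (a : TwistedGroupAlgebra f) : f.actLin g a = f.act g a := rfl

theorem act_smul (g : G) (c : ℂ) (a : TwistedGroupAlgebra f) :
    f.act g (c • a) = c • f.act g a :=
  map_smul (f.actLin g) c a

/-- `u_g u_h` and `u_{gh}` differ by a scalar, which cancels in conjugation. -/
theorem act_mul_left (g h : G) (a : TwistedGroupAlgebra f) :
    f.act (g * h) a = f.act g (f.act h a) := by
  rw [act_eq_iff]
  have H : (f g h : ℂ) • ((f.u (g * h) : TwistedGroupAlgebra f) * a) =
      (f g h : ℂ) • (f.act g (f.act h a) * f.u (g * h)) := by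
    rw [← smul_mul_assoc, ← mul_smul_comm, ← u_mul_u, mul_assoc, u_mul h, ← mul_assoc, u_mul g,
      mul_assoc]
  exact smul_right_injective _ (f g h).ne_zero H

theorem act_one (a : TwistedGroupAlgebra f) : f.act 1 a = a := by
  rw [act_eq_iff, u_one, smul_mul_assoc, one_mul, mul_smul_comm, mul_one]

theorem act_inv (g : G) (a : TwistedGroupAlgebra f) :
    f.act g⁻¹ a = ((f.u g)⁻¹ : (TwistedGroupAlgebra f)ˣ) * a * f.u g := by
  have h : f.act g (f.act g⁻¹ a) = a := by rw [← act_mul_left, mul_inv_cancel, act_one]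
  rw [act_eq_iff] at h
  rw [mul_assoc, ← h, Units.inv_mul_cancel_left]

theorem act_single_of_commute {g x : G} (h : g * x = x * g) (r : ℂ) :
    f.act g (single f x r) = (f.alpha g x : ℂ) • single f x r := by
  rw [act_eq_iff, u_eq_single, smul_single, single_mul_single, single_mul_single, h, alpha,
    one_mul, mul_one, Units.val_mul, mul_right_comm, mul_assoc (f g x : ℂ), Units.inv_mul, mul_one,
    mul_comm]

theorem exists_act_single (f : TwoCocycle G) (g x : G) :
    ∃ c : ℂˣ, ∀ r : ℂ, f.act g (single f x r) = single f (g * x * g⁻¹) (c * r) := by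
  refine ⟨f g x * (f (g * x * g⁻¹) g)⁻¹, fun r => ?_⟩
  rw [act_eq_iff, u_eq_single, single_mul_single, single_mul_single, inv_mul_cancel_right,
    Units.val_mul]
  congr 1
  field_simp
  rw [mul_assoc r, Units.inv_mul, mul_one]

theorem exists_coeff_act (f : TwoCocycle G) (g x : G) :
    ∃ c : ℂˣ, ∀ a, coeff f (g * x * g⁻¹) (f.act g a) = c * coeff f x a := by
  obtain ⟨c, hc⟩ := f.exists_act_single g x
  refine ⟨c, fun a => ?_⟩
  simp only [← actLin_apply] at hc ⊢
  induction a using TwistedGroupAlgebra.induction with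
  | h0 => simp
  | hadd a b h h' => rw [map_add, map_add, h, h', map_add, mul_add]
  | hs z r =>
    by_cases h : z = x
    · subst h
      rw [hc, coeff_single_self, coeff_single_self]
    · obtain ⟨d, hd⟩ := f.exists_act_single g z
      rw [actLin_apply, hd, coeff_single_of_ne h, coeff_single_of_ne (by simpa using h), mul_zero]

theorem coeff_act_of_commute {g x : G} (h : g * x = x * g) (a : TwistedGroupAlgebra f) :
    coeff f x (f.act g a) = f.alpha g x * coeff f x a := by
  obtain ⟨c, hc⟩ := f.exists_coeff_act g x
  have hx : g * x * g⁻¹ = x := by rw [h, mul_inv_cancel_right]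
  rw [hx] at hc
  have h1 := hc (single f x 1)
  rw [act_single_of_commute h, map_smul, coeff_single_self, mul_one, smul_eq_mul, mul_one] at h1
  rw [hc, h1]

/-- `alpha g x` is the eigenvalue of `g` on `u_x`, so it inherits multiplicativity from the action.
-/
theorem alpha_mul_left {g h x : G} (hg : g * x = x * g) (hh : h * x = x * h) :
    f.alpha (g * h) x = f.alpha g x * f.alpha h x := by
  have hgh : g * h * x = x * (g * h) := by rw [mul_assoc, hh, ← mul_assoc, hg, mul_assoc]
  have h1 := coeff_act_of_commute hgh (single f x 1)
  rw [act_mul_left, coeff_act_of_commute hg, coeff_act_of_commute hh, coeff_single_self, mul_one,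
    mul_one] at h1
  exact Units.ext (h1.symm.trans (Units.val_mul _ _).symm)

theorem alpha_swap (x y : G) : f.alpha x y = (f.alpha y x)⁻¹ := by
  simp [alpha]

theorem mul_mem_weightSpace {chi psi : G →* ℂˣ} {a b : TwistedGroupAlgebra f}
    (ha : a ∈ f.weightSpace chi) (hb : b ∈ f.weightSpace psi) :
    a * b ∈ f.weightSpace (chi * psi) := fun g => by
  rw [act_mul, ha, hb, smul_mul_smul_comm, MonoidHom.mul_apply, Units.val_mul]

theorem conj_mem_support {chi : G →* ℂˣ} {a : TwistedGroupAlgebra f}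
    (ha : a ∈ f.weightSpace chi) {x y : G} (hx : x ∈ a.support) (hxy : IsConj x y) :
    y ∈ a.support := by
  obtain ⟨g, rfl⟩ := isConj_iff.1 hxy
  obtain ⟨c, hc⟩ := f.exists_coeff_act g x
  have h := hc a
  rw [ha, map_smul, smul_eq_mul] at h
  rw [mem_support] at hx ⊢
  exact right_ne_zero_of_mul (h ▸ mul_ne_zero c.ne_zero hx)

theorem mem_centralizer_singleton {g x : G} :
    g ∈ Subgroup.centralizer {x} ↔ g * x = x * g := by
  rw [Subgroup.mem_centralizer_singleton_iff]

/-- For `g` centralizing `x`, the coefficient of `g(a)` at `x` is scaled by both `chi g` and `alpha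
g x`. -/
theorem isCharRegular_of_mem_support {chi : G →* ℂˣ} {a : TwistedGroupAlgebra f}
    (ha : a ∈ f.weightSpace chi) {x : G} (hx : x ∈ a.support) : f.IsCharRegular chi x := by
  intro g hg
  have h := coeff_act_of_commute (mem_centralizer_singleton.1 hg) a
  rw [ha, map_smul, smul_eq_mul] at h
  exact Units.ext (mul_right_cancel₀ hx h)

theorem isCharRegular_one_iff {x : G} : f.IsCharRegular 1 x ↔ f.IsRegular x := by
  refine forall₂_congr fun g _ => ?_
  rw [alpha_swap x g, inv_eq_one, MonoidHom.one_apply, eq_comm]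

/-! ### Averaging onto weight spaces. -/

section Reynolds

variable [Fintype G]

/-- The averaging operator `a ↦ ∑ g, chi(g)⁻¹ g(a)` onto the weight space of `chi`. -/
noncomputable def weightProj (f : TwoCocycle G) (chi : G →* ℂˣ) :
    TwistedGroupAlgebra f →ₗ[ℂ] TwistedGroupAlgebra f :=
  ∑ g, ((chi g)⁻¹ : ℂˣ) • f.actLin g

theorem weightProj_apply (chi : G →* ℂˣ) (a : TwistedGroupAlgebra f) :
    f.weightProj chi a = ∑ g, (((chi g)⁻¹ : ℂˣ) : ℂ) • f.act g a := by
  simp [weightProj, actLin_apply, Units.smul_def]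

theorem weightProj_mem (chi : G →* ℂˣ) (a : TwistedGroupAlgebra f) :
    f.weightProj chi a ∈ f.weightSpace chi := by
  intro h
  rw [weightProj_apply, ← actLin_apply, map_sum, Finset.smul_sum]
  refine Fintype.sum_equiv (Equiv.mulLeft h) _ _ fun g => ?_
  rw [map_smul, actLin_apply, ← act_mul_left, Equiv.coe_mulLeft, smul_smul, map_mul, mul_inv,
    Units.val_mul, Units.mul_inv_cancel_left]

theorem weightProj_act (chi : G →* ℂˣ) (h : G) (a : TwistedGroupAlgebra f) :
    f.weightProj chi (f.act h a) = (chi h : ℂ) • f.weightProj chi a := by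
  rw [weightProj_apply, weightProj_apply, Finset.smul_sum]
  refine Fintype.sum_equiv (Equiv.mulRight h) _ _ fun g => ?_
  rw [← act_mul_left, Equiv.coe_mulRight, smul_smul, map_mul, mul_inv_rev,
    Units.val_mul, Units.mul_inv_cancel_left]

theorem weightProj_of_mem {chi : G →* ℂˣ} {a : TwistedGroupAlgebra f}
    (ha : a ∈ f.weightSpace chi) : f.weightProj chi a = (Fintype.card G : ℂ) • a := by
  simp [weightProj_apply, ha _, smul_smul, Nat.cast_smul_eq_nsmul]

/-- Some `g` centralizing `x` has `chi g ≠ alpha g x`; projecting `g(u_x)` produces both factors,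
which forces zero. -/
theorem weightProj_single_of_not_isCharRegular {chi : G →* ℂˣ} {x : G}
    (hx : ¬ f.IsCharRegular chi x) (r : ℂ) : f.weightProj chi (single f x r) = 0 := by
  simp only [IsCharRegular, not_forall] at hx
  obtain ⟨g, hg, hne⟩ := hx
  have h := f.weightProj_act chi g (single f x r)
  rw [act_single_of_commute (mem_centralizer_singleton.1 hg), map_smul, ← sub_eq_zero,
    ← sub_smul, smul_eq_zero, sub_eq_zero] at h
  exact h.resolve_left fun e => hne (Units.ext e.symm)

/-- Only the regular basis element `u_1` survives averaging. The factor `f 1 1` appears because `u_1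
= f(1,1) • 1` for a cocycle that need not be normalized. -/
theorem weightProj_one (hf : f.IsNondegenerate) (a : TwistedGroupAlgebra f) :
    f.weightProj 1 a = (Fintype.card G * coeff f 1 a * f 1 1 : ℂ) • 1 := by
  induction a using TwistedGroupAlgebra.induction with
  | h0 => simp
  | hadd a b h h' => rw [map_add, h, h', map_add, ← add_smul]; ring_nf
  | hs x r =>
    by_cases hx : x = 1
    · subst hx
      rw [weightProj_of_mem, coeff_single_self, single_eq_smul_u, u_one, smul_smul, smul_smul,
        mul_assoc]
      intro g
      rw [single_eq_smul_u, u_one, act_smul, act_smul]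
      simp [act]
    · rw [weightProj_single_of_not_isCharRegular, coeff_single_of_ne hx, mul_zero, zero_mul,
        zero_smul]
      rwa [isCharRegular_one_iff, hf]

/-- Every weight space of a nondegenerate cocycle contains a nonzero average. -/
theorem exists_weightProj_ne_zero (hf : f.IsNondegenerate) (chi : G →* ℂˣ) :
    ∃ a, f.weightProj chi a ≠ 0 := by
  by_contra! h
  -- The commutator `u_x⁻¹ u_g u_x u_g⁻¹` is read as `u_x⁻¹ g(u_x)` or as `x⁻¹(u_g) u_g⁻¹`. Summed
  -- over `x` and `g` with weight `chi(g)⁻¹`, the first reading gives zero by assumption.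
  have h1 : ∑ x, (((f.u x)⁻¹ : (TwistedGroupAlgebra f)ˣ) : TwistedGroupAlgebra f) *
      f.weightProj chi (f.u x) =
      ∑ g, (((chi g)⁻¹ : ℂˣ) : ℂ) • (f.weightProj 1 (f.u g) *
        ((f.u g)⁻¹ : (TwistedGroupAlgebra f)ˣ)) := by
    simp only [weightProj_apply, Finset.mul_sum, Finset.sum_mul, Finset.smul_sum]
    rw [Finset.sum_comm]
    refine Finset.sum_congr rfl fun g _ => ?_
    refine Fintype.sum_equiv (Equiv.inv G) _ _ fun x => ?_
    have hx : (((f.u x)⁻¹ : (TwistedGroupAlgebra f)ˣ) : TwistedGroupAlgebra f) * f.act g (f.u x) =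
        f.act x⁻¹ (f.u g) * ((f.u g)⁻¹ : (TwistedGroupAlgebra f)ˣ) := by
      rw [act_inv]
      simp only [act, mul_assoc]
    rw [Equiv.inv_apply, mul_smul_comm, hx, MonoidHom.one_apply, inv_one, Units.val_one, one_smul]
  simp only [h, mul_zero, Finset.sum_const_zero, weightProj_one hf] at h1
  -- In the second reading only `g = 1` contributes, and its term is a nonzero scalar times a unit.
  rw [Finset.sum_eq_single 1] at h1
  · have h2 := h1.symm
    rw [u_eq_single, coeff_single_self, smul_mul_assoc, one_mul, smul_smul, smul_eq_zero] at h2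
    rcases h2 with h2 | h2
    · simp at h2
    · exact ((f.u 1)⁻¹).ne_zero h2
  · intro g _ hg
    rw [u_eq_single, coeff_single_of_ne hg]
    simp
  · simp

end Reynolds

/-! ### Weight spaces are lines spanned by invertible elements. -/

theorem smul_one_of_mem_weightSpace_one [Finite G] (hf : f.IsNondegenerate)
    {a : TwistedGroupAlgebra f} (ha : a ∈ f.weightSpace 1) : ∃ k : ℂ, a = k • 1 := by
  have := Fintype.ofFinite G
  have h := weightProj_of_mem ha
  have hG : (Fintype.card G : ℂ) ≠ 0 := by simp
  rw [weightProj_one hf] at h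
  exact ⟨(Fintype.card G : ℂ)⁻¹ * (Fintype.card G * coeff f 1 a * f 1 1),
    by rw [mul_smul, h, inv_smul_smul₀ hG]⟩

theorem weightProj_one_mul [Fintype G] {chi : G →* ℂˣ} {a : TwistedGroupAlgebra f}
    (ha : a ∈ f.weightSpace chi) (c : TwistedGroupAlgebra f) :
    f.weightProj 1 (c * a) = f.weightProj chi⁻¹ c * a := by
  simp [weightProj_apply, act_mul, ha _, Finset.sum_mul]

/-- For `y` in the support of `a`, `u_{y⁻¹} a` has nonzero coefficient at `1`, so its average is a
nonzero scalar. That average is also `weightProj chi⁻¹ (u_{y⁻¹}) * a`, which exhibits the inverse.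
-/
theorem exists_mul_eq_one [Finite G] (hf : f.IsNondegenerate) {chi : G →* ℂˣ}
    {a : TwistedGroupAlgebra f} (ha : a ∈ f.weightSpace chi) (h0 : a ≠ 0) :
    ∃ b ∈ f.weightSpace chi⁻¹, b * a = 1 := by
  have := Fintype.ofFinite G
  obtain ⟨y, hy⟩ := exists_mem_support h0
  have h := weightProj_one_mul ha (f.u y⁻¹)
  have h1 := coeff_mul_u_mul y⁻¹ y a
  rw [inv_mul_cancel] at h1
  rw [weightProj_one hf, h1] at h
  have hk : (Fintype.card G * (f y⁻¹ y * coeff f y a) * f 1 1 : ℂ) ≠ 0 :=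
    mul_ne_zero (mul_ne_zero (by simp) (mul_ne_zero (Units.ne_zero _) hy)) (Units.ne_zero _)
  exact ⟨_, Submodule.smul_mem _ (_)⁻¹ (weightProj_mem chi⁻¹ (f.u y⁻¹)),
    by rw [smul_mul_assoc, ← h, inv_smul_smul₀ hk]⟩

/-- The weight spaces of a nondegenerate cocycle are at most one-dimensional. -/
theorem exists_eq_smul [Finite G] (hf : f.IsNondegenerate) {chi : G →* ℂˣ}
    {a b : TwistedGroupAlgebra f} (ha : a ∈ f.weightSpace chi) (h0 : a ≠ 0)
    (hb : b ∈ f.weightSpace chi) : ∃ k : ℂ, b = k • a := by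
  obtain ⟨c, hc, hca⟩ := exists_mul_eq_one hf ha h0
  -- `b * c` is invariant, hence a scalar `k`, and `b = (b * c) * a = k • a`.
  have h1 := mul_mem_weightSpace hb hc
  rw [show chi * chi⁻¹ = 1 from mul_inv_cancel chi] at h1
  obtain ⟨k, hk⟩ := smul_one_of_mem_weightSpace_one hf h1
  exact ⟨k, by rw [← mul_one b, ← hca, ← mul_assoc, hk, smul_mul_assoc, one_mul]⟩

theorem mul_ne_zero_of_mem_weightSpace [Finite G] (hf : f.IsNondegenerate) {chi : G →* ℂˣ}
    {a b : TwistedGroupAlgebra f} (ha : a ∈ f.weightSpace chi) (h0 : a ≠ 0) (hb : b ≠ 0) :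
    a * b ≠ 0 := by
  obtain ⟨c, -, hca⟩ := exists_mul_eq_one hf ha h0
  intro h
  rw [← one_mul b, ← hca, mul_assoc, h, mul_zero] at hb
  exact hb rfl

theorem exists_mem_weightSpace_ne_zero [Finite G] (hf : f.IsNondegenerate) (chi : G →* ℂˣ) :
    ∃ a ∈ f.weightSpace chi, a ≠ 0 := by
  have := Fintype.ofFinite G
  obtain ⟨a, ha⟩ := exists_weightProj_ne_zero hf chi
  exact ⟨_, weightProj_mem chi a, ha⟩

theorem exists_isCharRegular [Finite G] (hf : f.IsNondegenerate) (chi : G →* ℂˣ) :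
    ∃ x, f.IsCharRegular chi x := by
  obtain ⟨a, ha, h0⟩ := exists_mem_weightSpace_ne_zero hf chi
  obtain ⟨x, hx⟩ := exists_mem_support h0
  exact ⟨x, isCharRegular_of_mem_support ha hx⟩

/-! ### Supports are single conjugacy classes. -/

theorem mem_support_weightProj_single [Fintype G] {chi : G →* ℂˣ} {x : G}
    (hx : f.IsCharRegular chi x) : x ∈ (f.weightProj chi (f.u x)).support := by
  classical
  rw [mem_support, weightProj_apply, map_sum]
  have h : ∀ g, coeff f x ((((chi g)⁻¹ : ℂˣ) : ℂ) • f.act g (f.u x)) =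
      if g ∈ Subgroup.centralizer {x} then 1 else 0 := by
    intro g
    rw [map_smul]
    split_ifs with hg
    · rw [coeff_act_of_commute (mem_centralizer_singleton.1 hg), ← hx g hg, u_eq_single,
        coeff_single_self, mul_one, smul_eq_mul, Units.inv_mul]
    · obtain ⟨c, hc⟩ := f.exists_act_single g x
      rw [u_eq_single, hc, coeff_single_of_ne, smul_zero]
      rwa [mem_centralizer_singleton, ← mul_inv_eq_iff_eq_mul] at hg
  rw [Finset.sum_congr rfl fun g _ => h g, Finset.sum_boole, Nat.cast_ne_zero,
    ← Nat.pos_iff_ne_zero, Finset.card_pos]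
  exact ⟨1, by simp⟩

theorem support_weightProj_single_subset [Fintype G] (chi : G →* ℂˣ) (x : G) :
    (f.weightProj chi (f.u x)).support ⊆ conjugatesOf x := by
  intro y hy
  by_contra hxy
  refine hy ?_
  change coeff f y _ = 0
  rw [weightProj_apply, map_sum]
  refine Finset.sum_eq_zero fun g _ => ?_
  obtain ⟨c, hc⟩ := f.exists_act_single g x
  rw [map_smul, u_eq_single, hc, coeff_single_of_ne, smul_zero]
  rintro rfl
  exact hxy (isConj_iff.2 ⟨g, rfl⟩)

/-- Averaging `u_x` gives a semi-invariant with `x` in its support, and such supports are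
conjugation-stable; no cocycle computation is needed. -/
theorem IsCharRegular.conj [Finite G] {chi : G →* ℂˣ} {x y : G} (hx : f.IsCharRegular chi x)
    (hxy : IsConj x y) : f.IsCharRegular chi y := by
  have := Fintype.ofFinite G
  have h := weightProj_mem (f := f) chi (f.u x)
  exact isCharRegular_of_mem_support h (conj_mem_support h (mem_support_weightProj_single hx) hxy)

theorem support_eq_conjugatesOf [Finite G] (hf : f.IsNondegenerate) {chi : G →* ℂˣ} {x : G}
    (hx : f.IsCharRegular chi x) {a : TwistedGroupAlgebra f} (ha : a ∈ f.weightSpace chi)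
    (h0 : a ≠ 0) : a.support = conjugatesOf x := by
  have := Fintype.ofFinite G
  obtain ⟨k, hk⟩ := exists_eq_smul hf ha h0 (weightProj_mem chi (f.u x))
  have hs := mem_support_weightProj_single hx
  have key : ∀ y, y ∈ (f.weightProj chi (f.u x)).support ↔ y ∈ a.support := by
    intro y
    rw [hk, mem_support, map_smul, smul_eq_mul] at hs
    rw [hk, mem_support, mem_support, map_smul, smul_eq_mul]
    exact mul_ne_zero_iff_left (left_ne_zero_of_mul hs)
  refine Set.Subset.antisymm (fun y hy => ?_) fun y hy => ?_
  · exact support_weightProj_single_subset chi x ((key y).2 hy)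
  · exact conj_mem_support ha ((key x).1 hs) hy

theorem IsCharRegular.isConj [Finite G] (hf : f.IsNondegenerate) {chi : G →* ℂˣ} {x y : G}
    (hx : f.IsCharRegular chi x) (hy : f.IsCharRegular chi y) : IsConj x y := by
  obtain ⟨a, ha, h0⟩ := exists_mem_weightSpace_ne_zero hf chi
  have h := (support_eq_conjugatesOf hf hx ha h0).symm.trans (support_eq_conjugatesOf hf hy ha h0)
  exact (Set.ext_iff.1 h y).2 mem_conjugatesOf_self

theorem monoidHom_eq_of_isConj {A : Type*} [CommGroup A] (phi : G →* A) {x y : G}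
    (h : IsConj x y) : phi x = phi y :=
  isConj_iff_eq.1 (phi.map_isConj h)

/-- `u_y a = y(a) u_y = chi(y) • a u_y`, and `chi` is constant on the class supporting `b`. -/
theorem mul_eq_smul_mul {chi : G →* ℂˣ} {a b : TwistedGroupAlgebra f} {x : G}
    (ha : a ∈ f.weightSpace chi) (hb : b.support ⊆ conjugatesOf x) [Finite G] :
    b * a = (chi x : ℂ) • (a * b) := by
  have := Fintype.ofFinite G
  rw [← sum_coeff_smul_u b, Finset.sum_mul, Finset.mul_sum, Finset.smul_sum]
  refine Finset.sum_congr rfl fun y _ => ?_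
  by_cases hy : coeff f y b = 0
  · simp [hy]
  · rw [monoidHom_eq_of_isConj chi (hb hy), smul_mul_assoc, u_mul, ha, mul_smul_comm,
      smul_mul_assoc, smul_comm]

/-- Products of `chi`-regular and `psi`-regular elements, up to `G'`. -/
theorem IsCharRegular.of_mul [Finite G] (hf : f.IsNondegenerate) {chi psi : G →* ℂˣ} {x y z : G}
    (hx : f.IsCharRegular chi x) (hy : f.IsCharRegular psi y)
    (hz : f.IsCharRegular (chi * psi) z) :
    Abelianization.of z = Abelianization.of x * Abelianization.of y := by
  have := Fintype.ofFinite G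
  obtain ⟨a, ha, ha0⟩ := exists_mem_weightSpace_ne_zero hf chi
  obtain ⟨b, hb, hb0⟩ := exists_mem_weightSpace_ne_zero hf psi
  have hab := mul_mem_weightSpace ha hb
  have hab0 := mul_ne_zero_of_mem_weightSpace hf ha ha0 hb0
  have hza : z ∈ (a * b).support := by
    rw [support_eq_conjugatesOf hf hz hab hab0]
    exact mem_conjugatesOf_self
  rw [mem_support, ← sum_coeff_smul_u a, Finset.sum_mul, map_sum] at hza
  obtain ⟨g, -, hg⟩ := Finset.exists_ne_zero_of_sum_ne_zero hza
  rw [smul_mul_assoc, map_smul, smul_eq_mul] at hg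
  have h2 := right_ne_zero_of_mul hg
  -- With `z = g * (g⁻¹ * z)`, the coefficient at `z` splits into one of `a` at `g` and one of `b`
  -- at `g⁻¹ * z`.
  rw [← mul_inv_cancel_left g z, coeff_mul_u_mul] at h2
  have h3 : g ∈ a.support := left_ne_zero_of_mul hg
  have h4 : g⁻¹ * z ∈ b.support := right_ne_zero_of_mul h2
  rw [support_eq_conjugatesOf hf hx ha ha0] at h3
  rw [support_eq_conjugatesOf hf hy hb hb0] at h4
  rw [monoidHom_eq_of_isConj Abelianization.of h3, monoidHom_eq_of_isConj Abelianization.of h4,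
    ← map_mul, mul_inv_cancel_left]

/-! ### The homomorphism `phi` and its kernel. -/

theorem exists_isSupportHom [Finite G] (hf : f.IsNondegenerate) :
    ∃ phi : (G →* ℂˣ) →* Abelianization G, f.IsSupportHom phi := by
  choose x hx using exists_isCharRegular hf
  refine ⟨MonoidHom.mk' (fun chi => Abelianization.of (x chi))
    fun chi psi => (hx chi).of_mul hf (hx psi) (hx (chi * psi)), fun chi => ⟨x chi, ?_, ?_, rfl⟩⟩
  · exact (Submodule.ne_bot_iff _).2 (exists_mem_weightSpace_ne_zero hf chi)
  · exact fun a ha h0 => support_eq_conjugatesOf hf (hx chi) ha h0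

theorem IsSupportHom.apply_eq [Finite G] {phi : (G →* ℂˣ) →* Abelianization G}
    (hf : f.IsNondegenerate) (hphi : f.IsSupportHom phi) {chi : G →* ℂˣ} {x : G}
    (hx : f.IsCharRegular chi x) : phi chi = Abelianization.of x := by
  obtain ⟨y, hbot, hy, h⟩ := hphi chi
  obtain ⟨a, ha, h0⟩ := (Submodule.ne_bot_iff _).1 hbot
  have hxy := (hy a ha h0).symm.trans (support_eq_conjugatesOf hf hx ha h0)
  have hc : y ∈ conjugatesOf x := hxy ▸ mem_conjugatesOf_self (a := y)
  rw [h, monoidHom_eq_of_isConj Abelianization.of hc]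

theorem IsSupportHom.apply_eq_one_iff [Finite G] {phi : (G →* ℂˣ) →* Abelianization G}
    (hf : f.IsNondegenerate) (hphi : f.IsSupportHom phi) {chi : G →* ℂˣ} {x : G}
    (hx : f.IsCharRegular chi x) : phi chi = 1 ↔ x ∈ commutator G := by
  rw [hphi.apply_eq hf hx, ← MonoidHom.mem_ker, Abelianization.ker_of]

theorem existsUnique_isSupportHom [Finite G] (hf : f.IsNondegenerate) :
    ∃! phi : (G →* ℂˣ) →* Abelianization G, f.IsSupportHom phi := by
  obtain ⟨phi, hphi⟩ := exists_isSupportHom hf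
  refine ⟨phi, hphi, fun psi hpsi => MonoidHom.ext fun chi => ?_⟩
  obtain ⟨x, hx⟩ := exists_isCharRegular hf chi
  rw [hphi.apply_eq hf hx, hpsi.apply_eq hf hx]

theorem exists_isRegularTransversal [Finite G] (f : TwoCocycle G) :
    ∃ Γ : Set G, f.IsRegularTransversal Γ := by
  have hout : ∀ x : G, IsConj x (Quotient.out (ConjClasses.mk x)) := fun x =>
    (ConjClasses.mk_eq_mk_iff_isConj.1 (Quotient.out_eq (ConjClasses.mk x))).symm
  refine ⟨{x | (∃ chi, f.IsCharRegular chi x) ∧ Quotient.out (ConjClasses.mk x) = x},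
    fun x hx => hx.1, fun x ⟨chi, hx⟩ => ?_⟩
  refine ⟨Quotient.out (ConjClasses.mk x), ⟨⟨⟨chi, hx.conj (hout x)⟩, ?_⟩, hout x⟩, ?_⟩
  · rw [← ConjClasses.mk_eq_mk_iff_isConj.2 (hout x)]
  · rintro y ⟨⟨-, hy⟩, hxy⟩
    rw [← hy, ConjClasses.mk_eq_mk_iff_isConj.2 hxy]

theorem center_le_commutator [Finite G] {phi : (G →* ℂˣ) →* Abelianization G}
    (hf : f.IsNondegenerate) (hphi : f.IsSupportHom phi) (h : phi.ker = ⊤) :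
    Subgroup.center G ≤ commutator G := by
  intro x hx
  have hc : ∀ g, g * x = x * g := Subgroup.mem_center_iff.1 hx
  -- For central `x`, `alpha · x` is a character of all of `G`, and `x` is regular for it.
  let chi : G →* ℂˣ := MonoidHom.mk' (fun g => f.alpha g x) fun g h => alpha_mul_left (hc g) (hc h)
  have hchi : f.IsCharRegular chi x := fun g _ => rfl
  rw [← hphi.apply_eq_one_iff hf hchi, ← MonoidHom.mem_ker, h]
  trivial

theorem IsCharRegular.card_eq [Finite G] {chi : G →* ℂˣ} {x : G} (hx : f.IsCharRegular chi x) :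
    Nat.card {psi : G →* ℂˣ // f.IsCharRegular psi x} =
      (commutator G ⊔ Subgroup.centralizer {x}).index := by
  rw [← card_monoidHom_le_ker le_sup_left]
  refine Nat.card_congr ((Equiv.mulLeft chi⁻¹).subtypeEquiv fun psi => ?_)
  rw [sup_le_iff, and_iff_right (Abelianization.commutator_subset_ker _)]
  refine forall₂_congr fun g hg => ?_
  rw [MonoidHom.mem_ker, Equiv.coe_mulLeft, MonoidHom.mul_apply, MonoidHom.inv_apply, hx g hg,
    inv_mul_eq_one, eq_comm]

/-- Each `chi` has exactly one representative `r chi` in `Γ`, and `chi` lies in the kernel iff `r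
chi ∈ G'`. The fibre of `r` over `x` is counted by `IsCharRegular.card_eq`. -/
theorem finsum_index_eq_card_ker [Finite G] (hf : f.IsNondegenerate)
    {phi : (G →* ℂˣ) →* Abelianization G} (hphi : f.IsSupportHom phi) {Γ : Set G}
    (hΓ : f.IsRegularTransversal Γ) :
    ∑ᶠ x ∈ Γ ∩ (commutator G : Set G), (commutator G ⊔ Subgroup.centralizer {x}).index =
      Nat.card phi.ker := by
  classical
  have := Fintype.ofFinite (G →* ℂˣ)
  have hex : ∀ chi, ∃ y ∈ Γ, f.IsCharRegular chi y := fun chi => by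
    obtain ⟨x, hx⟩ := exists_isCharRegular hf chi
    obtain ⟨y, ⟨hy, hxy⟩, -⟩ := hΓ.2 x ⟨chi, hx⟩
    exact ⟨y, hy, hx.conj hxy⟩
  choose r hrΓ hr using hex
  have hrx : ∀ chi, ∀ x ∈ Γ, f.IsCharRegular chi x ↔ r chi = x := fun chi x hx => by
    refine ⟨fun h => ?_, fun h => h ▸ hr chi⟩
    exact (hΓ.2 x ⟨chi, h⟩).unique ⟨hrΓ chi, h.isConj hf (hr chi)⟩ ⟨hx, .refl x⟩
  rw [finsum_mem_eq_finite_toFinset_sum _ (Set.toFinite _),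
    Nat.card_eq_fintype_card, Fintype.card_subtype,
    Finset.card_eq_sum_card_fiberwise (f := r)
      (t := (Set.toFinite (Γ ∩ (commutator G : Set G))).toFinset)]
  · refine Finset.sum_congr rfl fun x hx => ?_
    rw [Set.Finite.mem_toFinset] at hx
    obtain ⟨chi, hchi⟩ := hΓ.1 x hx.1
    rw [← hchi.card_eq, Nat.card_eq_fintype_card, Fintype.card_subtype, Finset.filter_filter]
    congr 1
    ext psi
    simp only [Finset.mem_filter, Finset.mem_univ, true_and]
    rw [hrx psi x hx.1, MonoidHom.mem_ker, iff_and_self]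
    rintro rfl
    exact (hphi.apply_eq_one_iff hf (hr psi)).2 hx.2
  · intro chi hchi
    rw [Finset.mem_coe, Finset.mem_filter, MonoidHom.mem_ker,
      hphi.apply_eq_one_iff hf (hr chi)] at hchi
    rw [Finset.mem_coe, Set.Finite.mem_toFinset]
    exact ⟨hrΓ chi, hchi.2⟩

/-! ### The semi-center as a twisted group algebra. -/

/-- Nonzero vectors of distinct weights are linearly independent. -/
theorem linearIndependent_of_mem_weightSpace [Finite G]
    {v : (G →* ℂˣ) → TwistedGroupAlgebra f}
    (hv : ∀ chi, v chi ∈ f.weightSpace chi) (h0 : ∀ chi, v chi ≠ 0) : LinearIndependent ℂ v := by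
  have := Fintype.ofFinite (G →* ℂˣ)
  rw [Fintype.linearIndependent_iff]
  intro c hc chi
  obtain ⟨x, hx⟩ := exists_mem_support (h0 chi)
  have hinj : Function.Injective fun psi : G →* ℂˣ => (Units.coeHom ℂ).comp psi := by
    intro psi psi' h
    ext g
    exact DFunLike.congr_fun h g
  have hind := (linearIndependent_monoidHom G ℂ).comp _ hinj
  rw [Fintype.linearIndependent_iff] at hind
  -- Applying every `g` to the relation and reading the coefficient at `x` gives a relation between
  -- characters, so Dedekind independence applies; `x` lies in the support of `v chi`, so that
  -- factor cancels.
  refine (mul_eq_zero.1 (hind (fun psi => c psi * coeff f x (v psi)) ?_ chi)).resolve_right hx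
  funext g
  have h := congrArg (fun a => coeff f x (f.actLin g a)) hc
  simp only [map_sum, map_smul, actLin_apply, hv _ g, map_zero] at h
  rw [Finset.sum_apply, Pi.zero_apply, ← h]
  refine Finset.sum_congr rfl fun psi _ => ?_
  simp only [Function.comp_apply, Pi.smul_apply, MonoidHom.comp_apply, Units.coeHom_apply,
    smul_eq_mul]
  ring

theorem mem_semicenter_iff_mem_span [Finite G] (hf : f.IsNondegenerate)
    {v : (G →* ℂˣ) → TwistedGroupAlgebra f}
    (hv : ∀ chi, v chi ∈ f.weightSpace chi) (h0 : ∀ chi, v chi ≠ 0)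
    {a : TwistedGroupAlgebra f} :
    a ∈ f.semicenter ↔ a ∈ Submodule.span ℂ (Set.range v) := by
  change a ∈ Submodule.span ℂ {a | f.IsSemiInvariant a} ↔ _
  suffices h : Submodule.span ℂ {a | f.IsSemiInvariant a} = Submodule.span ℂ (Set.range v) by
    rw [h]
  refine le_antisymm (Submodule.span_le.2 ?_) (Submodule.span_mono ?_)
  · rintro b ⟨-, chi, hb⟩
    obtain ⟨k, rfl⟩ := exists_eq_smul hf (hv chi) (h0 chi) hb
    exact Submodule.smul_mem _ _ (Submodule.subset_span ⟨chi, rfl⟩)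
  · rintro _ ⟨chi, rfl⟩
    exact ⟨h0 chi, chi, hv chi⟩

theorem exists_isSemicenterCocycle [Finite G] (hf : f.IsNondegenerate) :
    ∃ fhat : TwoCocycle (G →* ℂˣ), f.IsSemicenterCocycle fhat := by
  have := Fintype.ofFinite (G →* ℂˣ)
  choose v hv h0 using exists_mem_weightSpace_ne_zero hf
  have hne : ∀ chi psi, v chi * v psi ≠ 0 := fun chi psi =>
    mul_ne_zero_of_mem_weightSpace hf (hv chi) (h0 chi) (h0 psi)
  have hex : ∀ chi psi, ∃ k : ℂˣ, v chi * v psi = (k : ℂ) • v (chi * psi) := fun chi psi => by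
    obtain ⟨k, hk⟩ := exists_eq_smul hf (hv (chi * psi)) (h0 _)
      (mul_mem_weightSpace (hv chi) (hv psi))
    refine ⟨Units.mk0 k ?_, hk⟩
    rintro rfl
    exact hne chi psi (hk.trans (zero_smul _ _))
  choose k hk using hex
  let fhat : TwoCocycle (G →* ℂˣ) :=
    { toFun := k
      cocycle := fun x y z => by
        have h := mul_assoc (v x) (v y) (v z)
        rw [hk, hk, smul_mul_assoc, mul_smul_comm, hk, hk, smul_smul, smul_smul, mul_assoc x] at h
        exact Units.ext (smul_left_injective ℂ (h0 (x * (y * z))) h) }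
  have hmul : ∀ a b, lift fhat v (a * b) = lift fhat v a * lift fhat v b := by
    intro a b
    induction a using TwistedGroupAlgebra.induction with
    | h0 => simp
    | hadd a a' h h' => rw [add_mul, map_add, h, h', map_add, add_mul]
    | hs x r =>
      induction b using TwistedGroupAlgebra.induction with
      | h0 => simp
      | hadd b b' h h' => rw [mul_add, map_add, h, h', map_add, mul_add]
      | hs y s =>
        rw [single_mul_single, lift_single, lift_single, lift_single, smul_mul_smul_comm, hk,
          smul_smul]
  have hone : lift fhat v 1 = 1 := by
    obtain ⟨c, hc⟩ := smul_one_of_mem_weightSpace_one hf (hv 1)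
    have h := hk 1 1
    have hc0 : c ≠ 0 := by
      rintro rfl
      exact h0 1 (hc.trans (zero_smul _ _))
    rw [show (1 * 1 : G →* ℂˣ) = 1 from mul_one (1 : G →* ℂˣ), hc,
      smul_mul_smul_comm, mul_one, smul_smul] at h
    -- `v 1 = c • 1` squares to `k(1,1) • v 1`, which fixes `c` to match the unit `k(1,1)⁻¹ • u_1`.
    have h1 : c = k 1 1 := mul_right_cancel₀ hc0 (smul_left_injective ℂ one_ne_zero h)
    rw [one_def, lift_single, hc, h1, smul_smul]
    exact (congrArg (· • (1 : TwistedGroupAlgebra f)) (Units.inv_mul (k 1 1))).trans (one_smul _ _)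
  have hu : ∀ chi, lift fhat v (fhat.u chi) = v chi := fun chi => by
    rw [u_eq_single, lift_single, one_smul]
  let F : TwistedGroupAlgebra fhat →ₐ[ℂ] TwistedGroupAlgebra f :=
    AlgHom.ofLinearMap (lift fhat v) hone hmul
  have hF : Function.Injective F := by
    refine (injective_iff_map_eq_zero F).2 fun a ha => ext_coeff fun chi => ?_
    rw [map_zero]
    refine Fintype.linearIndependent_iff.1 (linearIndependent_of_mem_weightSpace hv h0)
      (fun chi => coeff fhat chi a) ?_ chi
    change lift fhat v a = 0 at ha
    rw [← ha]
    conv_rhs => rw [← sum_coeff_smul_u a]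
    simp only [map_sum, map_smul, hu]
  have hrange : F.range = f.semicenter := by
    ext a
    rw [mem_semicenter_iff_mem_span hf hv h0, AlgHom.mem_range]
    constructor
    · rintro ⟨b, rfl⟩
      change lift fhat v b ∈ _
      rw [← sum_coeff_smul_u b]
      simp only [map_sum, map_smul, hu]
      exact Submodule.sum_mem _ fun chi _ =>
        Submodule.smul_mem _ _ (Submodule.subset_span ⟨chi, rfl⟩)
    · intro ha
      have hle : Submodule.span ℂ (Set.range v) ≤ LinearMap.range (lift fhat v) :=
        Submodule.span_le.2 (by
          rintro _ ⟨chi, rfl⟩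
          exact ⟨_, hu chi⟩)
      exact hle ha
  refine ⟨fhat, (AlgEquiv.ofInjective F hF).trans (Subalgebra.equivOfEq _ _ hrange), fun chi => ?_⟩
  change lift fhat v (fhat.u chi) ∈ _
  rw [hu]
  exact hv chi

/-- On the abelian group of characters a coboundary is symmetric, so the algebra commutes.
Conversely, a complex point `E` gives `t chi = E(u_chi)`, nonzero since `u_chi` is a unit. -/
theorem isCohomologicallyTrivial_iff_commute [Finite G] {fhat : TwoCocycle (G →* ℂˣ)}
    (hfhat : f.IsSemicenterCocycle fhat) :
    fhat.IsCohomologicallyTrivial ↔ ∀ a ∈ f.semicenter, ∀ b ∈ f.semicenter, a * b = b * a := by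
  obtain ⟨e, -⟩ := hfhat
  constructor
  · rintro ⟨t, ht⟩
    have hcomm : ∀ a b : TwistedGroupAlgebra fhat, a * b = b * a := by
      intro a b
      induction a using TwistedGroupAlgebra.induction with
      | h0 => simp
      | hadd a a' h h' => rw [add_mul, h, h', mul_add]
      | hs x r =>
        induction b using TwistedGroupAlgebra.induction with
        | h0 => simp
        | hadd b b' h h' => rw [mul_add, h, h', add_mul]
        | hs y s =>
          rw [single_mul_single, single_mul_single, ht, ht y, mul_comm y x, mul_comm r,
            mul_comm (t x)]
    intro a ha b hb
    have h := congrArg (fun c => ((e c : f.semicenter) : TwistedGroupAlgebra f))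
      (hcomm (e.symm ⟨a, ha⟩) (e.symm ⟨b, hb⟩))
    simpa using h
  · intro hcomm
    let : CommRing f.semicenter :=
      { (inferInstance : Ring f.semicenter) with
        mul_comm := fun a b => Subtype.ext (hcomm a a.2 b b.2) }
    obtain ⟨F⟩ := exists_algHom_complex f.semicenter
    let E : TwistedGroupAlgebra fhat →ₐ[ℂ] ℂ := F.comp e
    have hE : ∀ chi, E (fhat.u chi) ≠ 0 := fun chi =>
      ((fhat.u chi).isUnit.map E).ne_zero
    refine ⟨fun chi => Units.mk0 _ (hE chi), fun chi psi => ?_⟩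
    rw [eq_mul_inv_iff_mul_eq]
    ext
    have h := congrArg E (u_mul_u (f := fhat) chi psi)
    rw [map_mul, map_smul, smul_eq_mul] at h
    exact h.symm

theorem commute_semicenter_iff [Finite G] (hf : f.IsNondegenerate)
    {phi : (G →* ℂˣ) →* Abelianization G} (hphi : f.IsSupportHom phi) :
    (∀ a ∈ f.semicenter, ∀ b ∈ f.semicenter, a * b = b * a) ↔ phi.ker = ⊤ := by
  choose v hv h0 using exists_mem_weightSpace_ne_zero hf
  choose x hx using exists_isCharRegular hf
  have hsupp := fun psi => (support_eq_conjugatesOf hf (hx psi) (hv psi) (h0 psi)).subset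
  have hmem : ∀ chi, v chi ∈ f.semicenter := fun chi =>
    (mem_semicenter_iff_mem_span hf hv h0).2 (Submodule.subset_span ⟨chi, rfl⟩)
  constructor
  · intro h
    refine eq_top_iff.2 fun psi _ => ?_
    rw [MonoidHom.mem_ker, hphi.apply_eq hf (hx psi),
      -- Characters of the finite abelian group `G/G'` separate its points.
      ← CommGroup.forall_apply_eq_apply_iff (Abelianization G) (M := ℂ)]
    intro chi
    have h1 := mul_eq_smul_mul (hv (Abelianization.lift.symm chi)) (hsupp psi)
    rw [h _ (hmem psi) _ (hmem _)] at h1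
    have hne := mul_ne_zero_of_mem_weightSpace hf (hv (Abelianization.lift.symm chi)) (h0 _)
      (h0 psi)
    rw [map_one]
    exact Units.ext (smul_left_injective ℂ hne (h1.symm.trans (one_smul ℂ _).symm))
  · intro h a ha b hb
    rw [mem_semicenter_iff_mem_span hf hv h0] at ha hb
    have key : ∀ chi psi, v psi * v chi = v chi * v psi := by
      intro chi psi
      have hpsi : phi psi = 1 := by rw [← MonoidHom.mem_ker, h]; trivial
      rw [hphi.apply_eq_one_iff hf (hx psi)] at hpsi
      have h2 : chi (x psi) = 1 := Abelianization.commutator_subset_ker chi hpsi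
      rw [mul_eq_smul_mul (hv chi) (hsupp psi), h2, Units.val_one, one_smul]
    induction ha, hb using Submodule.span_induction₂ with
    | mem_mem a b ha hb =>
      obtain ⟨chi, rfl⟩ := ha
      obtain ⟨psi, rfl⟩ := hb
      exact key psi chi
    | zero_left | zero_right => simp
    | add_left a a' b _ _ _ h h' => rw [add_mul, h, h', mul_add]
    | add_right a b b' _ _ _ h h' => rw [mul_add, h, h', add_mul]
    | smul_left c a b _ _ h => rw [smul_mul_assoc, h, mul_smul_comm]
    | smul_right c a b _ _ h => rw [mul_smul_comm, h, smul_mul_assoc]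

end TwoCocycle

theorem mainTheorem6 {G : Type*} [Group G] [Finite G] (f : TwoCocycle G)
    (hf : f.IsNondegenerate) :
    (∃! phi : (G →* ℂˣ) →* Abelianization G, f.IsSupportHom phi) ∧
    (∃ fhat : TwoCocycle (G →* ℂˣ), f.IsSemicenterCocycle fhat) ∧
    (∃ Γ : Set G, f.IsRegularTransversal Γ) ∧
    ∀ phi : (G →* ℂˣ) →* Abelianization G, f.IsSupportHom phi →
    ∀ fhat : TwoCocycle (G →* ℂˣ), f.IsSemicenterCocycle fhat →
    ∀ Γ : Set G, f.IsRegularTransversal Γ →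
      List.TFAE [
        phi.ker = ⊤,
        ∀ (chi : G →* ℂˣ) (x : G), f.IsCharRegular chi x →
          conjugatesOf x ⊆ (commutator G : Set G),
        fhat.IsCohomologicallyTrivial,
        ∀ a ∈ f.semicenter, ∀ b ∈ f.semicenter, a * b = b * a,
        ∑ᶠ x ∈ Γ ∩ (commutator G : Set G),
          (commutator G ⊔ Subgroup.centralizer {x}).index = Nat.card (G →* ℂˣ)] ∧
      (phi.ker = ⊤ → Subgroup.center G ≤ commutator G) := by
  refine ⟨TwoCocycle.existsUnique_isSupportHom hf, TwoCocycle.exists_isSemicenterCocycle hf,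
    TwoCocycle.exists_isRegularTransversal f, fun phi hphi fhat hfhat Γ hΓ =>
      ⟨?_, TwoCocycle.center_le_commutator hf hphi⟩⟩
  tfae_have 1 ↔ 2 := by
    constructor
    · intro h chi x hx y hxy
      have hy := hx.conj hxy
      rw [SetLike.mem_coe, ← hphi.apply_eq_one_iff hf hy, ← MonoidHom.mem_ker, h]
      trivial
    · refine fun h => eq_top_iff.2 fun chi _ => ?_
      obtain ⟨x, hx⟩ := TwoCocycle.exists_isCharRegular hf chi
      rw [MonoidHom.mem_ker, hphi.apply_eq_one_iff hf hx]
      exact h chi x hx mem_conjugatesOf_self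
  tfae_have 3 ↔ 4 := TwoCocycle.isCohomologicallyTrivial_iff_commute hfhat
  tfae_have 4 ↔ 1 := TwoCocycle.commute_semicenter_iff hf hphi
  tfae_have 5 ↔ 1 := by
    rw [TwoCocycle.finsum_index_eq_card_ker hf hphi hΓ, Subgroup.card_eq_iff_eq_top]
  tfae_finish
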